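/- Let $G$ be a connected, locally finite graph without loops, finite or infinite, in which multiple edges are allowed; regard $G$ as an electrical network in which every edge has resistance $1$. For a finite set $T$ of vertices let $\mathrm{edge\_boundary}(T)$ be the set of edges connecting a vertex of $T$ to a vertex outside $T$. A swelling sequence is a sequence $(T_n)$ of finite vertex sets such that every finite vertex set is contained in $T_n$ for all large $n$. The graph $G$ is called smallish if it has a swelling sequence with $|\mathrm{edge\_boundary}(T_n)|/|T_n|\to 0$, and symmetrical if its automorphism group has only finitely many orbits on the vertices. For distinct vertices $p,q$, the even flow from $p$ to $q$ is the limit (in energy), as the finite vertex set $T$ swells to the whole vertex set, of the unit current flow from $p$ to $q$ in the finite network obtained from $G$ by discarding all vertices outside $T$ together with the edges incident with them; the odd flow from $p$ to $q$ is the corresponding limit for the finite networks obtained by identifying all vertices outside $T$ to a single vertex. The even (respectively odd) resistance between $p$ and $q$ is the energy (the sum over the edges of the squared current) of the even (respectively odd) flow. Corollary. If $G$ is smallish and symmetrical, then for all distinct vertices $p,q$ the even resistance and the odd resistance between $p$ and $q$ are well defined, finite and equal. Moreover $G$ is $O_{HD}$: every function $u$ on the vertices that is harmonic (that is, $\sum_{e}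 (u(x)-u(y_e))=0$ for every vertex $x$, where $e$ runs over the edges at $x$ and $y_e$ is the other end of $e$) and has finite energy $\sum_{e=xy}(u(x)-u(y))^2<\infty$ is constant. -/

import Mathlib

open Filter Topology
open scoped ENNReal NNReal Graph

/-! Multigraphs are Mathlib's `Graph α β`: vertex set `V(G) : Set α`, edge set `E(G) : Set β`, and
`G.IsLink e x y` says that the edge `e` has the ends `x` and `y`. Every edge is a resistor of
resistance `1`. -/

namespace Graph

variable {α β : Type*}

/-- A symmetry (automorphism) of a multigraph: a permutation of the vertices and a permutation of
the edges that respect incidence. -/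
structure Symmetry (G : Graph α β) where
  vert : V(G) ≃ V(G)
  edge : E(G) ≃ E(G)
  isLink_iff : ∀ (e : E(G)) (x y : V(G)),
    G.IsLink (edge e) (vert x) (vert y) ↔ G.IsLink e x y

/-- Two vertices are of the same kind if some symmetry maps the first to the second. -/
def SameKind (G : Graph α β) (x y : V(G)) : Prop :=
  ∃ σ : G.Symmetry, σ.vert x = y

/-- A graph is symmetrical if it has only finitely many kinds of vertices: every vertex is of the
same kind as a member of some fixed finite set. -/
def IsSymmetrical (G : Graph α β) : Prop :=
  ∃ F : Finset V(G), ∀ x : V(G), ∃ y ∈ F, G.SameKind y x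

/-- Every vertex has finite valence. -/
def IsLocallyFinite (G : Graph α β) : Prop :=
  ∀ x ∈ V(G), (G.incidenceSet x).Finite

/-- The vertices belonging to `T`, as a subset of the ambient type. -/
def verts (G : Graph α β) (T : Finset V(G)) : Set α :=
  Subtype.val '' (T : Set V(G))

/-- The edges that connect a vertex of `T` to a vertex outside `T`. -/
def edgeBoundary (G : Graph α β) (T : Finset V(G)) : Set β :=
  {e | ∃ x y, G.IsLink e x y ∧ x ∈ G.verts T ∧ y ∉ G.verts T}

/-- A swelling sequence: finite sets of vertices that eventually contain any given finite set of
vertices. -/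
def IsSwelling (G : Graph α β) (T : ℕ → Finset V(G)) : Prop :=
  ∀ S : Finset V(G), ∀ᶠ n in atTop, S ⊆ T n

/-- A pinching sequence: a swelling sequence along which `|edge boundary of T| / |T|` tends
to `0`. -/
def IsPinching (G : Graph α β) (T : ℕ → Finset V(G)) : Prop :=
  G.IsSwelling T ∧
    Tendsto (fun n => ((G.edgeBoundary (T n)).ncard : ℝ) / ((T n).card : ℝ)) atTop (𝓝 0)

/-- A graph is smallish if it has a pinching sequence. -/
def IsSmallish (G : Graph α β) : Prop :=
  ∃ T : ℕ → Finset V(G), G.IsPinching T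

/-- The cut network of `T`: discard the vertices outside `T` and the edges incident with them. -/
def cutNetwork (G : Graph α β) (T : Finset V(G)) : Graph α β :=
  G.induce (G.verts T)

open Classical in
/-- The map that identifies all vertices outside `T` to the single point `∞ = none`. -/
noncomputable def shortMap (G : Graph α β) (T : Finset V(G)) (x : α) : Option α :=
  if x ∈ G.verts T then some x else none

/-- The short network of `T`: identify all the vertices outside `T` to a single new vertex. (Edges
with no end in `T` become loops at that vertex; they never carry any current.) -/
noncomputable def shortNetwork (G : Graph α β) (T : Finset V(G)) : Graph (Option α) β :=
  G.map (G.shortMap T)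

/-! A flow is a function `i : β → α → ℝ`, where `i e x` is the current that leaves the vertex `x`
through the edge `e`; so `i e x = - i e y` if `e` links `x` and `y`, and `i e x = 0` if `e` is not
incident with `x`. -/

open Classical in
/-- The flow of the function (potential) `u`, by Ohm's law for resistances `1`: if `e` links `x`
and `y`, then the current leaving `x` through `e` is `u x - u y`. -/
noncomputable def flowOf (G : Graph α β) (u : α → ℝ) : β → α → ℝ :=
  fun e x => if h : G.Inc e x then u x - u h.other else 0

theorem flowOf_of_isLink {G : Graph α β} (u : α → ℝ) {e : β} {x y : α} (h : G.IsLink e x y) :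
    G.flowOf u e x = u x - u y := by
  have hx : G.Inc e x := ⟨y, h⟩
  have : hx.other = y := hx.isLink_other.right_unique h
  rw [flowOf, dif_pos hx, this]

/-- The source strength of the flow `i` at `x`: the total current leaving `x`. -/
noncomputable def source (G : Graph α β) (i : β → α → ℝ) (x : α) : ℝ :=
  ∑ᶠ e ∈ G.incidenceSet x, i e x

/-- The energy (dissipation) of a flow: the sum over the edges of the squared current. The double
sum meets each edge twice, once at each of its two ends. -/
noncomputable def energy (i : β → α → ℝ) : ℝ≥0∞ :=
  (∑' e, ∑' x, ENNReal.ofReal (i e x ^ 2)) / 2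

open Classical in
/-- `i` is the unit current flow from `p` to `q` in a finite network `H`, as determined by
Kirchhoff's laws: it is the flow of a potential, and it has a source of strength `1` at `p`, of
strength `-1` at `q`, and no other sources. -/
def IsUnitCurrent (H : Graph α β) (p q : α) (i : β → α → ℝ) : Prop :=
  (∃ u : α → ℝ, i = H.flowOf u) ∧
    ∀ x ∈ V(H), H.source i x = (if x = p then 1 else 0) - (if x = q then 1 else 0)

/-- `i` is the even flow from `p` to `q`: the limit, in energy, of the unit current flows from `p`
to `q` in the cut networks of `T`, as the finite set `T` swells to the whole vertex set. -/
def IsEvenFlow (G : Graph α β) (p q : α) (i : β → α → ℝ) : Prop :=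
  ∃ j : Finset V(G) → β → α → ℝ,
    (∀ᶠ T in atTop, (G.cutNetwork T).IsUnitCurrent p q (j T)) ∧
    Tendsto (fun T => energy (j T - i)) atTop (𝓝 0)

open Classical in
/-- A flow in the short network of `T`, read as a flow through the edges of `G`. -/
noncomputable def unshort (G : Graph α β) (T : Finset V(G)) (j : β → Option α → ℝ) :
    β → α → ℝ :=
  fun e x => if G.Inc e x then j e (G.shortMap T x) else 0

/-- `i` is the odd flow from `p` to `q`: the limit, in energy, of the unit current flows from `p`
to `q` in the short networks of `T`, as the finite set `T` swells to the whole vertex set. -/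
def IsOddFlow (G : Graph α β) (p q : α) (i : β → α → ℝ) : Prop :=
  ∃ j : Finset V(G) → β → Option α → ℝ,
    (∀ᶠ T in atTop, (G.shortNetwork T).IsUnitCurrent (some p) (some q) (j T)) ∧
    Tendsto (fun T => energy (G.unshort T (j T) - i)) atTop (𝓝 0)

/-- `r` is the even resistance between `p` and `q`: the energy of the even flow. -/
def IsEvenResistance (G : Graph α β) (p q : α) (r : ℝ≥0∞) : Prop :=
  ∃ i : β → α → ℝ, G.IsEvenFlow p q i ∧ energy i = r

/-- `r` is the odd resistance between `p` and `q`: the energy of the odd flow. -/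
def IsOddResistance (G : Graph α β) (p q : α) (r : ℝ≥0∞) : Prop :=
  ∃ i : β → α → ℝ, G.IsOddFlow p q i ∧ energy i = r

/-- A function is harmonic if its flow has no sources. -/
def IsHarmonic (G : Graph α β) (u : α → ℝ) : Prop :=
  ∀ x ∈ V(G), G.source (G.flowOf u) x = 0

/-- The class `O_HD`: every harmonic function of finite energy is constant. -/
def IsOHD (G : Graph α β) : Prop :=
  ∀ u : α → ℝ, G.IsHarmonic u → energy (G.flowOf u) < ⊤ →
    ∀ x ∈ V(G), ∀ y ∈ V(G), u x = u y

end Graph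

namespace Graph

variable {α β : Type*} {G : Graph α β}

/-! Membership in `O_HD` is a dimension count. Let `u` be harmonic, of finite energy `E`, with
current `c ≠ 0` through some edge at `x`. On a finite set `T`, flows of potentials harmonic on `T`
are determined by their values on boundary edges, so they form a space of dimension at most `|∂T|`
(`finrank_map_flowRestrict_le`). Symmetries carry `u` to each vertex of `T` of the kind of `x`, so
this space has members of squared norm at most `2E` with coordinate `c` there. The diagonal entry of
the orthogonal projection at such a coordinate is thus at least `c²/2E`, while its trace is the
dimension (`card_mul_le_finrank`). Hence the kind of `x` has density `0` along a pinching sequence.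
Density `0` spreads to adjacent kinds, hence by connectedness to all kinds; but finitely many kinds
cover `T`, a contradiction.

For the resistances, fix a finitely supported unit flow `θ` in the Hilbert space of square-summable
functions on darts. The current in the cut network is `θ` minus its projection to the cycles in `T`;
the current in the short network is the projection of `θ` to the span of the stars of `T`. Both
families of subspaces increase with `T`, so both currents converge. The difference of the limits has
no sources and is the flow of a potential, so it vanishes by `O_HD`: the even and odd flows
coincide. -/

/-! ### Flows of potentials and reversal of darts. -/

theorem flowOf_of_not_inc (u : α → ℝ) {e : β} {x : α} (h : ¬ G.Inc e x) : G.flowOf u e x = 0 :=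
  dif_neg h

theorem flowOf_add (u v : α → ℝ) : G.flowOf (u + v) = G.flowOf u + G.flowOf v := by
  ext e x
  by_cases h : G.Inc e x <;> simp [flowOf, h]
  ring

theorem flowOf_smul (c : ℝ) (u : α → ℝ) : G.flowOf (c • u) = c • G.flowOf u := by
  ext e x
  by_cases h : G.Inc e x <;> simp [flowOf, h]
  ring

theorem flowOf_swap (u : α → ℝ) {e : β} {x y : α} (h : G.IsLink e x y) :
    G.flowOf u e y = - G.flowOf u e x := by
  rw [flowOf_of_isLink u h, flowOf_of_isLink u h.symm, neg_sub]

theorem mem_verts {T : Finset V(G)} {x : V(G)} : (x : α) ∈ G.verts T ↔ x ∈ T := by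
  simp [verts]

theorem verts_subset (T : Finset V(G)) : G.verts T ⊆ V(G) := by
  rintro _ ⟨x, -, rfl⟩; exact x.2

theorem finite_verts (T : Finset V(G)) : (G.verts T).Finite := T.finite_toSet.image _

theorem verts_mono {S T : Finset V(G)} (h : S ⊆ T) : G.verts S ⊆ G.verts T :=
  Set.image_mono (by exact_mod_cast h)

/-- A property that passes along edges holds everywhere in a connected graph. -/
theorem induction_of_connected (hconn : G.toSimpleGraph.Connected) {P : α → Prop} {o : α}
    (ho : o ∈ V(G)) (h0 : P o) (step : ∀ e x y, G.IsLink e x y → P x → P y) :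
    ∀ x ∈ V(G), P x := by
  intro x hx
  obtain ⟨w⟩ := hconn.preconnected ⟨o, ho⟩ ⟨x, hx⟩
  have key : ∀ a b : V(G), G.toSimpleGraph.Walk a b → P a → P b := by
    intro a b w
    induction w with
    | nil => exact id
    | cons h _ ih =>
      obtain ⟨-, e, he⟩ := h
      exact fun ha => ih (step e _ _ he ha)
  exact key _ _ w h0

open Classical in
/-- The reversal of darts: `(e, x)` goes to `(e, y)` if `e` links `x` and `y`. -/
noncomputable def rev (G : Graph α β) (d : β × α) : β × α :=
  if h : G.Inc d.1 d.2 then (d.1, h.other) else d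

theorem rev_of_isLink {e : β} {x y : α} (h : G.IsLink e x y) : G.rev (e, x) = (e, y) := by
  have hx : G.Inc e x := ⟨y, h⟩
  have : hx.other = y := hx.isLink_other.right_unique h
  rw [rev, dif_pos hx, this]

theorem rev_of_not_inc {d : β × α} (h : ¬ G.Inc d.1 d.2) : G.rev d = d := dif_neg h

theorem rev_involutive (G : Graph α β) : Function.Involutive G.rev := by
  rintro ⟨e, x⟩
  by_cases h : G.Inc e x
  · obtain ⟨y, h⟩ := h
    rw [rev_of_isLink h, rev_of_isLink h.symm]
  · rw [rev_of_not_inc (d := (e, x)) h, rev_of_not_inc (d := (e, x)) h]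

theorem flowOf_rev (u : α → ℝ) (d : β × α) :
    G.flowOf u (G.rev d).1 (G.rev d).2 = - G.flowOf u d.1 d.2 := by
  obtain ⟨e, x⟩ := d
  by_cases h : G.Inc e x
  · obtain ⟨y, h⟩ := h
    rw [rev_of_isLink h, flowOf_swap u h]
  · rw [rev_of_not_inc h, flowOf_of_not_inc u h, neg_zero]

theorem flowOf_eq_rev (u : α → ℝ) (d : β × α) :
    G.flowOf u d.1 d.2 = u d.2 - u (G.rev d).2 := by
  obtain ⟨e, x⟩ := d
  by_cases h : G.Inc e x
  · obtain ⟨y, h⟩ := h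
    rw [rev_of_isLink h, flowOf_of_isLink u h]
  · rw [rev_of_not_inc h, flowOf_of_not_inc u h, sub_self]

/-! ### Harmonic potentials on a finite set, and its boundary. -/

/-- The darts whose tail is a vertex of `T`. -/
def dartsFrom (G : Graph α β) (T : Finset V(G)) : Set (β × α) :=
  {d | G.Inc d.1 d.2 ∧ d.2 ∈ G.verts T}

theorem IsLocallyFinite.finite_incidenceSet (hfin : G.IsLocallyFinite) (x : α) :
    (G.incidenceSet x).Finite := by
  by_cases hx : x ∈ V(G)
  · exact hfin x hx
  · convert Set.finite_empty
    ext e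
    simp only [mem_incidenceSet, Set.mem_empty_iff_false, iff_false]
    exact fun h => hx h.vertex_mem

theorem IsLocallyFinite.finite_dartsFrom (hfin : G.IsLocallyFinite) (T : Finset V(G)) :
    (G.dartsFrom T).Finite := by
  have : G.dartsFrom T = ⋃ x ∈ G.verts T, (fun e => (e, x)) '' G.incidenceSet x := by
    ext ⟨e, x⟩
    simp [dartsFrom, and_comm]
  rw [this]
  exact (finite_verts T).biUnion fun x _ => (hfin.finite_incidenceSet x).image _

theorem sum_dartsFrom (hfin : G.IsLocallyFinite) (T : Finset V(G)) (u : α → ℝ)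
    (i : β → α → ℝ) (h : ∀ x ∈ G.verts T, G.source i x = 0) :
    ∑ d ∈ (hfin.finite_dartsFrom T).toFinset, u d.2 * i d.1 d.2 = 0 := by
  rw [Finset.sum_finset_product_right' _ (finite_verts T).toFinset
    (fun x => (hfin.finite_incidenceSet x).toFinset) (f := fun e x => u x * i e x)
    (by simp [dartsFrom, and_comm])]
  refine Finset.sum_eq_zero fun x hx => ?_
  have := h x (by simpa using hx)
  rw [source, finsum_mem_eq_finite_toFinset_sum _ (hfin.finite_incidenceSet x)] at this
  rw [← Finset.mul_sum, this, mul_zero]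

/-- A potential that is harmonic on `T` and whose flow vanishes on the boundary of `T` has no flow
at all at the vertices of `T`. -/
theorem flowOf_eq_zero_of_edgeBoundary (hfin : G.IsLocallyFinite) {T : Finset V(G)} {u : α → ℝ}
    (hs : ∀ x ∈ G.verts T, G.source (G.flowOf u) x = 0)
    (hb : ∀ d ∈ G.dartsFrom T, d.1 ∈ G.edgeBoundary T → G.flowOf u d.1 d.2 = 0) :
    ∀ d ∈ G.dartsFrom T, G.flowOf u d.1 d.2 = 0 := by
  classical
  set W := (hfin.finite_dartsFrom T).toFinset with hW
  -- `W₀` holds the darts with both ends in `T`; any other dart of `W` lies on a boundary edge.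
  set W₀ := W.filter fun d => G.rev d ∈ W with hW₀
  have hout : ∀ d ∈ W, d ∉ W₀ → G.flowOf u d.1 d.2 = 0 := by
    rintro ⟨e, x⟩ hd hd₀
    have hd' : (e, x) ∈ G.dartsFrom T := by simpa [hW] using hd
    obtain ⟨⟨y, hy⟩, hx⟩ := hd'
    refine hb _ (by simpa [hW] using hd) ⟨x, y, hy, hx, fun hyT => hd₀ ?_⟩
    rw [hW₀, Finset.mem_filter]
    refine ⟨hd, ?_⟩
    rw [rev_of_isLink hy, hW, Set.Finite.mem_toFinset]
    exact ⟨hy.inc_right, hyT⟩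
  have h0 : ∑ d ∈ W₀, u d.2 * G.flowOf u d.1 d.2 = 0 := by
    rw [← sum_dartsFrom hfin T u _ hs]
    refine Finset.sum_subset (Finset.filter_subset _ _) fun d hd hd₀ => ?_
    rw [hout d hd hd₀, mul_zero]
  have hmem : ∀ d ∈ W₀, G.rev d ∈ W₀ := by
    intro d hd
    rw [hW₀, Finset.mem_filter] at hd ⊢
    rw [rev_involutive]
    exact hd.symm
  -- Reversal permutes `W₀` and changes the sign of the flow; subtracting this sum from `h0` leaves
  -- the energy inside `T`.
  have h1 : ∑ d ∈ W₀, u (G.rev d).2 * G.flowOf u d.1 d.2 = 0 := by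
    rw [← neg_eq_zero, ← Finset.sum_neg_distrib, ← h0]
    refine Finset.sum_nbij' G.rev G.rev hmem hmem (fun d _ => rev_involutive G d)
      (fun d _ => rev_involutive G d) fun d _ => ?_
    rw [flowOf_rev, mul_neg]
  have h2 : ∑ d ∈ W₀, G.flowOf u d.1 d.2 ^ 2 = 0 := by
    have h := congrArg₂ (· - ·) h0 h1
    simp only [sub_zero, ← Finset.sum_sub_distrib] at h
    rw [← h]
    refine Finset.sum_congr rfl fun d _ => ?_
    rw [← sub_mul, ← flowOf_eq_rev, sq]
  intro d hd
  by_cases hd₀ : d ∈ W₀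
  · exact pow_eq_zero_iff two_ne_zero |>.1
      ((Finset.sum_eq_zero_iff_of_nonneg fun d _ => sq_nonneg _).1 h2 d hd₀)
  · exact hout d (by simpa [hW] using hd) hd₀

theorem IsLocallyFinite.finite_edgeBoundary (hfin : G.IsLocallyFinite) (T : Finset V(G)) :
    (G.edgeBoundary T).Finite := by
  refine ((hfin.finite_dartsFrom T).image Prod.fst).subset ?_
  rintro e ⟨x, y, h, hx, -⟩
  exact ⟨(e, x), ⟨h.inc_left, hx⟩, rfl⟩

theorem source_add (hfin : G.IsLocallyFinite) (i j : β → α → ℝ) (x : α) :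
    G.source (i + j) x = G.source i x + G.source j x :=
  finsum_mem_add_distrib (hfin.finite_incidenceSet x)

theorem source_smul (c : ℝ) (i : β → α → ℝ) (x : α) :
    G.source (c • i) x = c * G.source i x := by
  simp only [source, Pi.smul_apply, smul_eq_mul, mul_finsum_mem]

/-- The flow of a potential, restricted to a finite set of darts. -/
noncomputable def flowRestrict (G : Graph α β) (W : Finset (β × α)) :
    (α → ℝ) →ₗ[ℝ] EuclideanSpace ℝ W where
  toFun u := WithLp.toLp 2 fun d => G.flowOf u d.1.1 d.1.2
  map_add' u v := by ext; simp [flowOf_add]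
  map_smul' c u := by ext; simp [flowOf_smul]

/-- The potentials that are harmonic on `T`. -/
def harmonicOn (hfin : G.IsLocallyFinite) (T : Finset V(G)) : Submodule ℝ (α → ℝ) where
  carrier := {u | ∀ x ∈ G.verts T, G.source (G.flowOf u) x = 0}
  add_mem' hu hv x hx := by
    rw [flowOf_add, source_add hfin, hu x hx, hv x hx, add_zero]
  zero_mem' x hx := by
    rw [← zero_smul ℝ (0 : α → ℝ), flowOf_smul, source_smul, zero_mul]
  smul_mem' c u hu x hx := by
    rw [flowOf_smul, source_smul, hu x hx, mul_zero]

/-- By `flowOf_eq_zero_of_edgeBoundary`, restriction to the boundary coordinates is injective on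
this space. Each boundary edge has just one end in `T`, hence gives one coordinate. -/
theorem finrank_map_flowRestrict_le (hfin : G.IsLocallyFinite) (T : Finset V(G)) :
    Module.finrank ℝ ((harmonicOn hfin T).map
      (G.flowRestrict (hfin.finite_dartsFrom T).toFinset)) ≤ (G.edgeBoundary T).ncard := by
  classical
  set W := (hfin.finite_dartsFrom T).toFinset with hW
  set M := (harmonicOn hfin T).map (G.flowRestrict W)
  let W' : Finset W := Finset.univ.filter fun d => d.1.1 ∈ G.edgeBoundary T
  let L : EuclideanSpace ℝ W →ₗ[ℝ] (W' → ℝ) :=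
    { toFun := fun v d => v d.1
      map_add' := fun _ _ => rfl
      map_smul' := fun _ _ => rfl }
  have hinj : Function.Injective (L.comp M.subtype) := by
    rw [← LinearMap.ker_eq_bot, LinearMap.ker_eq_bot']
    rintro ⟨_, u, hu, rfl⟩ h
    ext d
    refine flowOf_eq_zero_of_edgeBoundary hfin hu (fun d hd hb => ?_) d.1
      ((Set.Finite.mem_toFinset _).1 d.2)
    exact congrFun h ⟨⟨d, by simpa [hW] using hd⟩, by simpa [W'] using hb⟩
  refine (LinearMap.finrank_le_finrank_of_injective hinj).trans ?_
  rw [Module.finrank_fintype_fun_eq_card, Fintype.card_coe, ← Set.ncard_coe_finset]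
  refine Set.ncard_le_ncard_of_injOn (fun d : W => d.1.1) (by simp [W']) ?_
    (hfin.finite_edgeBoundary T)
  rintro ⟨⟨e, x⟩, hx⟩ h ⟨⟨e', x'⟩, hx'⟩ h' heq
  obtain rfl : e = e' := heq
  obtain ⟨a, b, hab, ha, hb⟩ : e ∈ G.edgeBoundary T := by simpa [W'] using h
  have h1 : (e, x) ∈ G.dartsFrom T := by simpa [hW] using hx
  have h2 : (e, x') ∈ G.dartsFrom T := by simpa [hW] using hx'
  have key : ∀ z, (e, z) ∈ G.dartsFrom T → z = a := by
    intro z hz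
    rcases hz.1.eq_or_eq_of_isLink hab with h | rfl
    · exact h
    · exact absurd hz.2 hb
  have : x = x' := (key _ h1).trans (key _ h2).symm
  subst this
  rfl

/-! ### The trace estimate. -/

/-- Coordinates at which a subspace has large members are few compared with its dimension. -/
theorem card_mul_le_finrank {ι : Type*} [Fintype ι] (M : Submodule ℝ (EuclideanSpace ℝ ι))
    (A : Finset ι) {B c : ℝ} (hB : 0 ≤ B)
    (h : ∀ w ∈ A, ∃ v ∈ M, ‖v‖ ^ 2 ≤ B ∧ c ≤ v w ^ 2) :
    c * A.card ≤ B * Module.finrank ℝ M := by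
  let b := stdOrthonormalBasis ℝ M
  -- `∑ j, (b j) w ^ 2` is the diagonal entry at `w` of the projection to `M`; Cauchy–Schwarz bounds
  -- it below. Summed over all `w` it gives the trace.
  have hw : ∀ w ∈ A, c ≤ B * ∑ j, (b j : EuclideanSpace ℝ ι) w ^ 2 := by
    intro w hw
    obtain ⟨v, hv, hvB, hvc⟩ := h w hw
    have h1 : v w = ∑ j, inner ℝ (b j) (⟨v, hv⟩ : M) * (b j : EuclideanSpace ℝ ι) w := by
      have := congrArg (fun z : M => (z : EuclideanSpace ℝ ι) w) (b.sum_repr' ⟨v, hv⟩)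
      simpa using this.symm
    have h2 : ∑ j, inner ℝ (b j) (⟨v, hv⟩ : M) ^ 2 = ‖v‖ ^ 2 := by
      have := b.sum_sq_norm_inner_right (⟨v, hv⟩ : M)
      simpa using this
    refine hvc.trans ?_
    rw [h1]
    refine (Finset.sum_mul_sq_le_sq_mul_sq _ _ _).trans ?_
    rw [h2]
    exact mul_le_mul_of_nonneg_right hvB (Finset.sum_nonneg fun _ _ => sq_nonneg _)
  calc c * A.card = ∑ w ∈ A, c := by rw [Finset.sum_const, nsmul_eq_mul, mul_comm]
    _ ≤ ∑ w ∈ A, B * ∑ j, (b j : EuclideanSpace ℝ ι) w ^ 2 := Finset.sum_le_sum hw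
    _ ≤ ∑ w, B * ∑ j, (b j : EuclideanSpace ℝ ι) w ^ 2 :=
        Finset.sum_le_sum_of_subset_of_nonneg (Finset.subset_univ _) fun _ _ _ =>
          mul_nonneg hB (Finset.sum_nonneg fun _ _ => sq_nonneg _)
    _ = B * ∑ j, ∑ w, (b j : EuclideanSpace ℝ ι) w ^ 2 := by
        rw [← Finset.mul_sum, Finset.sum_comm]
    _ = B * ∑ j, (1 : ℝ) := by
        congr 1
        refine Finset.sum_congr rfl fun j _ => ?_
        rw [← EuclideanSpace.real_norm_sq_eq]
        have := b.orthonormal.1 j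
        rw [Submodule.coe_norm] at this
        rw [this, one_pow]
    _ = B * Module.finrank ℝ M := by simp

/-! ### Energy, symmetries and the frequency of kinds. -/

theorem source_flowOf (u : α → ℝ) (x : α) :
    G.source (G.flowOf u) x = ∑ᶠ e, G.flowOf u e x := by
  rw [source, finsum_mem_def]
  refine finsum_congr fun e => ?_
  by_cases h : G.Inc e x
  · exact Set.indicator_of_mem (s := G.incidenceSet x) h _
  · rw [flowOf_of_not_inc u h]
    exact Set.indicator_of_notMem (s := G.incidenceSet x) h _

theorem energy_eq_tsum (i : β → α → ℝ) :
    energy i = (∑' d : β × α, ENNReal.ofReal (i d.1 d.2 ^ 2)) / 2 := by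
  rw [energy, ← ENNReal.tsum_prod (f := fun e x => ENNReal.ofReal (i e x ^ 2))]

theorem sum_sq_le_energy {i : β → α → ℝ} (hi : energy i ≠ ⊤) (W : Finset (β × α)) :
    ∑ d ∈ W, i d.1 d.2 ^ 2 ≤ 2 * (energy i).toReal := by
  have h : ∑ d ∈ W, ENNReal.ofReal (i d.1 d.2 ^ 2) ≤ 2 * energy i := by
    rw [energy_eq_tsum, ENNReal.mul_div_cancel (by simp) (by simp)]
    exact ENNReal.sum_le_tsum W
  rw [← ENNReal.ofReal_sum_of_nonneg fun d _ => sq_nonneg _] at h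
  have := (ENNReal.ofReal_le_iff_le_toReal (ENNReal.mul_ne_top (by simp) hi)).1 h
  simpa using this

/-- A symmetry extends to permutations of the ambient types. -/
theorem Symmetry.exists_perm (σ : G.Symmetry) :
    ∃ (φ : Equiv.Perm α) (ψ : Equiv.Perm β), (∀ x : V(G), φ x = σ.vert x) ∧
      ∀ e x y, G.IsLink (ψ e) (φ x) (φ y) ↔ G.IsLink e x y := by
  classical
  let φ : Equiv.Perm α := Equiv.Perm.ofSubtype (p := (· ∈ V(G))) σ.vert
  let ψ : Equiv.Perm β := Equiv.Perm.ofSubtype (p := (· ∈ E(G))) σ.edge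
  have hφ : ∀ x : V(G), φ x = σ.vert x := fun x => Equiv.Perm.ofSubtype_apply_coe _ x
  have hψ : ∀ e : E(G), ψ e = σ.edge e := fun e => Equiv.Perm.ofSubtype_apply_coe _ e
  have hφ' : ∀ x, φ x ∈ V(G) ↔ x ∈ V(G) := fun x =>
    Equiv.Perm.ofSubtype_apply_mem_iff_mem (p := (· ∈ V(G))) σ.vert x
  have hψ' : ∀ e, ψ e ∈ E(G) ↔ e ∈ E(G) := fun e =>
    Equiv.Perm.ofSubtype_apply_mem_iff_mem (p := (· ∈ E(G))) σ.edge e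
  refine ⟨φ, ψ, hφ, fun e x y => ?_⟩
  by_cases h : e ∈ E(G) ∧ x ∈ V(G) ∧ y ∈ V(G)
  · obtain ⟨he, hx, hy⟩ := h
    rw [hψ ⟨e, he⟩, hφ ⟨x, hx⟩, hφ ⟨y, hy⟩]
    exact σ.isLink_iff ⟨e, he⟩ ⟨x, hx⟩ ⟨y, hy⟩
  · refine iff_of_false (fun h' => h ?_) (fun h' => h ⟨h'.edge_mem, h'.left_mem, h'.right_mem⟩)
    exact ⟨(hψ' e).1 h'.edge_mem, (hφ' x).1 h'.left_mem, (hφ' y).1 h'.right_mem⟩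

theorem inc_perm_iff {φ : Equiv.Perm α} {ψ : Equiv.Perm β}
    (hφψ : ∀ e x y, G.IsLink (ψ e) (φ x) (φ y) ↔ G.IsLink e x y) (e : β) (x : α) :
    G.Inc (ψ e) (φ x) ↔ G.Inc e x :=
  ⟨fun ⟨y, h⟩ => ⟨φ.symm y, by rw [← hφψ, φ.apply_symm_apply]; exact h⟩,
    fun ⟨y, h⟩ => ⟨φ y, (hφψ e x y).2 h⟩⟩

theorem flowOf_perm {φ : Equiv.Perm α} {ψ : Equiv.Perm β}
    (hφψ : ∀ e x y, G.IsLink (ψ e) (φ x) (φ y) ↔ G.IsLink e x y) (u : α → ℝ) (e : β) (x : α) :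
    G.flowOf (u ∘ φ.symm) (ψ e) (φ x) = G.flowOf u e x := by
  by_cases h : G.Inc e x
  · obtain ⟨y, h⟩ := h
    rw [flowOf_of_isLink _ h, flowOf_of_isLink _ ((hφψ e x y).2 h)]
    simp
  · rw [flowOf_of_not_inc _ h, flowOf_of_not_inc _ (mt (inc_perm_iff hφψ e x).1 h)]

theorem flowOf_perm_symm {φ : Equiv.Perm α} {ψ : Equiv.Perm β}
    (hφψ : ∀ e x y, G.IsLink (ψ e) (φ x) (φ y) ↔ G.IsLink e x y) (u : α → ℝ) (e : β) (x : α) :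
    G.flowOf (u ∘ φ.symm) e x = G.flowOf u (ψ.symm e) (φ.symm x) := by
  rw [← flowOf_perm hφψ u, ψ.apply_symm_apply, φ.apply_symm_apply]

theorem source_perm {φ : Equiv.Perm α} {ψ : Equiv.Perm β}
    (hφψ : ∀ e x y, G.IsLink (ψ e) (φ x) (φ y) ↔ G.IsLink e x y) (u : α → ℝ) (x : α) :
    G.source (G.flowOf (u ∘ φ.symm)) x = G.source (G.flowOf u) (φ.symm x) := by
  simp only [source_flowOf, flowOf_perm_symm hφψ]
  exact finsum_comp_equiv ψ.symm (f := fun e => G.flowOf u e (φ.symm x))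

theorem ncard_incidenceSet_perm {φ : Equiv.Perm α} {ψ : Equiv.Perm β}
    (hφψ : ∀ e x y, G.IsLink (ψ e) (φ x) (φ y) ↔ G.IsLink e x y) (x : α) :
    (G.incidenceSet (φ x)).ncard = (G.incidenceSet x).ncard := by
  rw [← Set.ncard_image_of_injective (G.incidenceSet x) ψ.injective]
  congr 1
  ext e
  constructor
  · intro h
    refine ⟨ψ.symm e, ?_, ψ.apply_symm_apply e⟩
    rw [mem_incidenceSet, ← inc_perm_iff hφψ, ψ.apply_symm_apply]
    exact h
  · rintro ⟨e, h, rfl⟩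
    exact (inc_perm_iff hφψ e x).2 h

open Classical in
/-- The vertices of `T` of the kind of a vertex that carries a current of a harmonic potential of
finite energy are few compared with the boundary of `T`. -/
theorem card_sameKind_le (hfin : G.IsLocallyFinite) {u : α → ℝ} (hu : G.IsHarmonic u)
    (hE : energy (G.flowOf u) ≠ ⊤) {x : V(G)} {e : β} (he : G.Inc e x) (T : Finset V(G)) :
    G.flowOf u e x ^ 2 * (T.filter (G.SameKind x)).card ≤
      2 * (energy (G.flowOf u)).toReal * (G.edgeBoundary T).ncard := by
  set W := (hfin.finite_dartsFrom T).toFinset with hW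
  have key : ∀ z ∈ T.filter (G.SameKind x), ∃ e' : β, G.Inc e' z ∧ ∃ v ∈ harmonicOn hfin T,
      ‖G.flowRestrict W v‖ ^ 2 ≤ 2 * (energy (G.flowOf u)).toReal ∧
      G.flowOf v e' z = G.flowOf u e x := by
    intro z hz
    obtain ⟨hzT, σ, rfl⟩ := Finset.mem_filter.1 hz
    obtain ⟨φ, ψ, hφ, h⟩ := σ.exists_perm
    rw [← hφ]
    refine ⟨ψ e, (inc_perm_iff h e x).2 he, u ∘ φ.symm, fun y hy => ?_, ?_, flowOf_perm h u e x⟩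
    · rw [source_perm h]
      by_cases hy' : φ.symm y ∈ V(G)
      · exact hu _ hy'
      -- No edge is incident with a point outside `V(G)`, so the source there is an empty sum.
      · rw [source]
        refine finsum_mem_eq_zero_of_forall_eq_zero fun e he => absurd he.vertex_mem hy'
    · rw [EuclideanSpace.real_norm_sq_eq]
      -- The transported flow on `W` is the original flow on the inverse image of `W`; the factor
      -- `2` counts both darts of each edge.
      refine le_trans (le_of_eq ?_) (sum_sq_le_energy hE
        (W.map (Equiv.prodCongr ψ.symm φ.symm).toEmbedding))
      rw [Finset.sum_map, ← Finset.sum_coe_sort W]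
      refine Finset.sum_congr rfl fun d _ => ?_
      simp [flowRestrict, flowOf_perm_symm h]
  have : Nonempty β := ⟨e⟩
  choose! f hf v hv hvB hvc using key
  have hfW : ∀ z ∈ T.filter (G.SameKind x), (f z, (z : α)) ∈ W := by
    intro z hz
    rw [hW, Set.Finite.mem_toFinset]
    exact ⟨hf z hz, mem_verts.2 (Finset.mem_filter.1 hz).1⟩
  let A : Finset W := (T.filter (G.SameKind x)).attach.image fun z =>
    ⟨(f z.1, (z.1 : α)), hfW _ z.2⟩
  have hA : A.card = (T.filter (G.SameKind x)).card := by
    rw [Finset.card_image_of_injective, Finset.card_attach]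
    rintro ⟨a, ha⟩ ⟨b, hb⟩ hab
    simp only [Subtype.mk.injEq, Prod.mk.injEq] at hab
    exact Subtype.ext (Subtype.ext hab.2)
  rw [← hA]
  refine (card_mul_le_finrank ((harmonicOn hfin T).map (G.flowRestrict W)) A
    (B := 2 * (energy (G.flowOf u)).toReal) (by positivity) ?_).trans ?_
  · intro w hw
    obtain ⟨⟨z, hz⟩, -, rfl⟩ := Finset.mem_image.1 hw
    exact ⟨_, Submodule.mem_map_of_mem (hv z hz), hvB z hz, (congrArg (· ^ 2) (hvc z hz)).ge⟩
  · gcongr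
    exact finrank_map_flowRestrict_le hfin T

open Classical in
/-- A kind of vertices whose members have adjacent members of another kind is at most as frequent
as the other kind, up to a constant factor and the size of the boundary. -/
theorem card_sameKind_le_of_isLink (hfin : G.IsLocallyFinite) {x y : V(G)} {e : β}
    (h : G.IsLink e x y) (T : Finset V(G)) :
    (T.filter (G.SameKind y)).card ≤ (G.edgeBoundary T).ncard +
      (T.filter (G.SameKind x)).card * (G.incidenceSet (x : α)).ncard := by
  let nb : V(G) → Finset V(G) := fun w =>
    (hfin w w.2).toFinset.image fun e =>
      -- The default `w` is never used: `e` runs over edges incident with `w`.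
      if h : G.Inc e w then ⟨h.other, h.inc_other.vertex_mem⟩ else w
  have hnb : ∀ {e} {w z : V(G)}, G.IsLink e w z → z ∈ nb w := by
    intro e w z h
    have hi : G.Inc e w := ⟨z, h⟩
    refine Finset.mem_image.2 ⟨e, by simpa using hi, ?_⟩
    rw [dif_pos hi]
    exact Subtype.ext (hi.isLink_other.right_unique h)
  have hnbc : ∀ w ∈ T.filter (G.SameKind x), (nb w).card ≤ (G.incidenceSet (x : α)).ncard := by
    intro w hw
    obtain ⟨-, σ, rfl⟩ := Finset.mem_filter.1 hw
    obtain ⟨φ, ψ, hφ, h⟩ := σ.exists_perm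
    refine Finset.card_image_le.trans ?_
    rw [← Set.ncard_eq_toFinset_card _ (hfin _ (σ.vert x).2), ← hφ, ncard_incidenceSet_perm h]
  -- Vertices of `T` at the boundary. A boundary edge has one end in `T`, so choosing such an edge
  -- for each is injective.
  let Z : Finset V(G) := T.filter fun z => ∃ e ∈ G.edgeBoundary T, G.Inc e z
  have hZ : Z.card ≤ (G.edgeBoundary T).ncard := by
    have h1 : ∀ z ∈ Z, ∃ e ∈ G.edgeBoundary T, G.Inc e z := fun z hz => (Finset.mem_filter.1 hz).2
    have : Nonempty β := ⟨e⟩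
    choose! g hg hg' using h1
    rw [← Set.ncard_coe_finset]
    refine Set.ncard_le_ncard_of_injOn g (fun z hz => hg z hz) (fun z hz z' hz' heq => ?_)
      (hfin.finite_edgeBoundary T)
    obtain ⟨a, b, hab, ha, hb⟩ := hg z hz
    have key : ∀ t : V(G), t ∈ T → G.Inc (g z) t → (t : α) = a := by
      intro t ht hi
      rcases hi.eq_or_eq_of_isLink hab with h | h
      · exact h
      · exact absurd (h ▸ mem_verts.2 ht : b ∈ G.verts T) hb
    exact Subtype.ext ((key z (Finset.mem_filter.1 hz).1 (hg' z hz)).trans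
      (key z' (Finset.mem_filter.1 hz').1 (heq ▸ hg' z' hz')).symm)
  calc (T.filter (G.SameKind y)).card
      ≤ (Z ∪ (T.filter (G.SameKind x)).biUnion nb).card := by
        refine Finset.card_le_card fun z hz => ?_
        obtain ⟨hzT, σ, rfl⟩ := Finset.mem_filter.1 hz
        obtain ⟨φ, ψ, hφ, hl⟩ := σ.exists_perm
        have hl' := (hl e x y).2 h
        rw [hφ, hφ] at hl'
        rw [Finset.mem_union]
        -- The neighbour `σ x` of `z = σ y` either lies in `T` or makes the joining edge a boundary
        -- edge.
        by_cases hx : σ.vert x ∈ T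
        · exact Or.inr (Finset.mem_biUnion.2 ⟨_, Finset.mem_filter.2 ⟨hx, σ, rfl⟩, hnb hl'⟩)
        · exact Or.inl (Finset.mem_filter.2 ⟨hzT, ψ e,
            ⟨_, _, hl'.symm, mem_verts.2 hzT, mt mem_verts.1 hx⟩, hl'.inc_right⟩)
    _ ≤ Z.card + ((T.filter (G.SameKind x)).biUnion nb).card := Finset.card_union_le _ _
    _ ≤ _ := Nat.add_le_add hZ (Finset.card_biUnion_le_card_mul _ _ _ hnbc)

/-- A smallish symmetrical graph belongs to the class `O_HD`. -/
theorem isOHD_of_isSmallish (hconn : G.toSimpleGraph.Connected) (hfin : G.IsLocallyFinite)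
    (hsmall : G.IsSmallish) (hsymm : G.IsSymmetrical) : G.IsOHD := by
  classical
  intro u hu hE p hp q hq
  by_contra hne
  obtain ⟨e, x, y, hxy, hu0⟩ : ∃ e x y, G.IsLink e x y ∧ G.flowOf u e x ≠ 0 := by
    by_contra! hcon
    refine hne (induction_of_connected hconn (P := fun z => u p = u z) hp rfl ?_ q hq)
    intro e x y h hx
    have := hcon e x y h
    rw [flowOf_of_isLink u h] at this
    linarith
  obtain ⟨T, hT, hlim⟩ := hsmall
  obtain ⟨F, hF⟩ := hsymm
  let dens : V(G) → ℕ → ℝ := fun z n =>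
    (((T n).filter (G.SameKind z)).card : ℝ) / ((T n).card : ℝ)
  have hdens0 : ∀ z n, 0 ≤ dens z n := fun z n => by positivity
  have h0 : Tendsto (dens ⟨x, hxy.left_mem⟩) atTop (𝓝 0) := by
    have hc : 0 < G.flowOf u e x ^ 2 := by positivity
    set B := 2 * (energy (G.flowOf u)).toReal
    refine squeeze_zero (hdens0 _) (fun n => ?_)
      (by simpa using hlim.const_mul (B / G.flowOf u e x ^ 2))
    have := card_sameKind_le hfin hu hE.ne (x := ⟨x, hxy.left_mem⟩) hxy.inc_left (T n)
    rw [← mul_div_assoc]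
    refine div_le_div_of_nonneg_right ?_ (Nat.cast_nonneg _)
    rw [div_mul_eq_mul_div, le_div_iff₀ hc, mul_comm]
    exact this
  have hall : ∀ z (hz : z ∈ V(G)), Tendsto (dens ⟨z, hz⟩) atTop (𝓝 0) := by
    intro z hz
    refine induction_of_connected hconn
      (P := fun z => ∀ hz : z ∈ V(G), Tendsto (dens ⟨z, hz⟩) atTop (𝓝 0))
      hxy.left_mem (fun _ => h0) ?_ z hz hz
    intro e' a b hab ha hb
    have ha' := ha hab.left_mem
    refine squeeze_zero (hdens0 _) (fun n => ?_)
      (by simpa using hlim.add (ha'.mul_const ((G.incidenceSet a).ncard : ℝ)))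
    have := card_sameKind_le_of_isLink hfin (x := ⟨a, hab.left_mem⟩) (y := ⟨b, hb⟩) hab (T n)
    simp only [dens]
    rw [div_mul_eq_mul_div, ← add_div]
    refine div_le_div_of_nonneg_right ?_ (Nat.cast_nonneg _)
    exact_mod_cast this
  have hsum : Tendsto (fun n => ∑ z ∈ F, dens z n) atTop (𝓝 0) := by
    simpa using tendsto_finsetSum F fun z _ => hall z z.2
  -- The finitely many kinds cover `T n`, so their densities sum to at least `1` once `T n` is
  -- nonempty.
  have h1 : ∀ᶠ n in atTop, 1 ≤ ∑ z ∈ F, dens z n := by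
    filter_upwards [hT {⟨x, hxy.left_mem⟩}] with n hn
    have hpos : 0 < ((T n).card : ℝ) := by
      exact_mod_cast Finset.card_pos.2 ⟨_, hn (Finset.mem_singleton_self _)⟩
    simp only [dens]
    rw [← Finset.sum_div, le_div_iff₀ hpos, one_mul]
    have : T n ⊆ F.biUnion fun z => (T n).filter (G.SameKind z) := by
      intro t ht
      obtain ⟨z, hz, hk⟩ := hF t
      exact Finset.mem_biUnion.2 ⟨z, hz, Finset.mem_filter.2 ⟨ht, hk⟩⟩
    exact_mod_cast (Finset.card_le_card this).trans Finset.card_biUnion_le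
  exact absurd (ge_of_tendsto hsum h1) (by norm_num)

/-! ### The Hilbert space of square-summable flows. -/

/-- The Hilbert space of square-summable functions on the pairs of an edge and a vertex. -/
abbrev DartSpace (α β : Type*) := lp (fun _ : β × α => ℝ) 2

/-- A square-summable function on darts, as a current. -/
def cur (v : DartSpace α β) : β → α → ℝ := fun e x => v (e, x)

theorem cur_injective : Function.Injective (cur : DartSpace α β → β → α → ℝ) := by
  intro v w h
  ext ⟨e, x⟩
  exact congrFun (congrFun h e) x

theorem energy_cur (v : DartSpace α β) : energy (cur v) = ENNReal.ofReal (‖v‖ ^ 2) / 2 := by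
  have h1 : ‖v‖ ^ 2 = ∑' d, v d ^ 2 := by
    rw [← real_inner_self_eq_norm_sq, lp.inner_eq_tsum]
    simp [sq]
  have h2 : Summable fun d => v d ^ 2 := by
    simpa [sq] using lp.summable_inner (𝕜 := ℝ) v v
  rw [energy_eq_tsum, h1, ENNReal.ofReal_tsum_of_nonneg (fun _ => sq_nonneg _) h2]
  rfl

theorem energy_cur_ne_top (v : DartSpace α β) : energy (cur v) ≠ ⊤ := by
  rw [energy_cur]
  exact (ENNReal.div_lt_top ENNReal.ofReal_ne_top (by simp)).ne

theorem tendsto_energy_sub {ι : Type*} {l : Filter ι} {v : ι → DartSpace α β} {w : DartSpace α β}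
    (h : Tendsto v l (𝓝 w)) : Tendsto (fun t => energy (cur (v t) - cur w)) l (𝓝 0) := by
  have h1 : Tendsto (fun t => ‖v t - w‖ ^ 2) l (𝓝 0) := by
    simpa using (tendsto_iff_norm_sub_tendsto_zero.1 h).pow 2
  have h2 := ENNReal.Tendsto.div_const (b := 2) (ENNReal.tendsto_ofReal h1) (by simp)
  simp only [ENNReal.ofReal_zero, ENNReal.zero_div] at h2
  refine h2.congr fun t => ?_
  rw [← energy_cur]
  rfl

theorem tendsto_apply_of_energy {ι : Type*} {l : Filter ι} {f : ι → β → α → ℝ} {i : β → α → ℝ}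
    (h : Tendsto (fun t => energy (f t - i)) l (𝓝 0)) (e : β) (x : α) :
    Tendsto (fun t => f t e x) l (𝓝 (i e x)) := by
  have h0 : Tendsto (fun t => ENNReal.ofReal ((f t e x - i e x) ^ 2)) l (𝓝 0) := by
    have h2 := ENNReal.Tendsto.const_mul (a := 2) h (Or.inr (by simp))
    rw [mul_zero] at h2
    refine tendsto_of_tendsto_of_tendsto_of_le_of_le tendsto_const_nhds h2 (fun _ => zero_le)
      fun t => ?_
    simp only [energy_eq_tsum]
    rw [ENNReal.mul_div_cancel (by simp) (by simp)]
    exact ENNReal.le_tsum (f := fun d : β × α => ENNReal.ofReal ((f t - i) d.1 d.2 ^ 2)) (e, x)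
  have h1 : Tendsto (fun t => (f t e x - i e x) ^ 2) l (𝓝 0) := by
    have := (ENNReal.tendsto_toReal (by simp)).comp h0
    simpa [Function.comp_def, ENNReal.toReal_ofReal (sq_nonneg _)] using this
  rw [tendsto_iff_norm_sub_tendsto_zero]
  have := (Real.continuous_sqrt.tendsto 0).comp h1
  simpa [Function.comp_def, Real.sqrt_sq_eq_abs] using this

theorem tendsto_apply {ι : Type*} {l : Filter ι} {v : ι → DartSpace α β} {w : DartSpace α β}
    (h : Tendsto v l (𝓝 w)) (e : β) (x : α) :
    Tendsto (fun t => cur (v t) e x) l (𝓝 (cur w e x)) :=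
  tendsto_apply_of_energy (tendsto_energy_sub h) e x

theorem eq_cur_of_tendsto {ι : Type*} {l : Filter ι} [l.NeBot] {v : ι → DartSpace α β}
    {w : DartSpace α β} (h : Tendsto v l (𝓝 w)) {i : β → α → ℝ}
    (hi : Tendsto (fun t => energy (cur (v t) - i)) l (𝓝 0)) : i = cur w := by
  ext e x
  exact tendsto_nhds_unique (tendsto_apply_of_energy hi e x) (tendsto_apply h e x)

/-- The square-summable flows. -/
def flowSpace (G : Graph α β) : Submodule ℝ (DartSpace α β) where
  carrier := {v | ∀ d, v (G.rev d) = - v d}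
  add_mem' hv hw d := by
    rw [lp.coeFn_add, Pi.add_apply, Pi.add_apply, hv, hw]
    ring
  zero_mem' d := by simp
  smul_mem' c v hv d := by
    rw [lp.coeFn_smul, Pi.smul_apply, Pi.smul_apply, hv, smul_neg]

theorem isClosed_flowSpace (G : Graph α β) : IsClosed (G.flowSpace : Set (DartSpace α β)) := by
  have hc : ∀ d : β × α, Continuous fun v : DartSpace α β => v d := fun d =>
    (continuous_apply d).comp lp.uniformContinuous_coe.continuous
  have : (G.flowSpace : Set (DartSpace α β)) = ⋂ d, {v | v (G.rev d) = - v d} := by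
    ext v; simp [flowSpace]
  rw [this]
  exact isClosed_iInter fun d => isClosed_eq (hc _) (hc _).neg

/-- `rev` fixes a dart that is not incident, so antisymmetry forces the value `0`. -/
theorem apply_eq_zero_of_not_inc {v : DartSpace α β} (hv : v ∈ G.flowSpace) {e : β} {x : α}
    (h : ¬ G.Inc e x) : v (e, x) = 0 := by
  have := hv (e, x)
  rw [rev_of_not_inc (d := (e, x)) h] at this
  linarith

theorem mem_flowSpace_of_cur_eq {v : DartSpace α β} {u : α → ℝ} (h : cur v = G.flowOf u) :
    v ∈ G.flowSpace := by
  intro d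
  have := flowOf_rev (G := G) u d
  rw [← h] at this
  exact this

/-- The two reversals differ only on edges of `G` missing from `H`, and there a flow of `H` vanishes
at both ends. -/
theorem flowSpace_mono {H : Graph α β} (hle : H ≤ G) : H.flowSpace ≤ G.flowSpace := by
  rintro v hv ⟨e, x⟩
  by_cases h : G.Inc e x
  · obtain ⟨y, h⟩ := h
    rw [rev_of_isLink h]
    by_cases h' : H.IsLink e x y
    · have := hv (e, x)
      rwa [rev_of_isLink h'] at this
    · have key : ∀ a b, G.IsLink e a b → ¬ H.IsLink e a b → v (e, a) = 0 := by
        intro a b hab hH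
        refine apply_eq_zero_of_not_inc hv fun ⟨c, hc⟩ => hH ?_
        rwa [hab.right_unique (hc.mono hle)]
      rw [key _ _ h h', key _ _ h.symm (mt IsLink.symm h'), neg_zero]
  · rw [rev_of_not_inc (d := (e, x)) h, apply_eq_zero_of_not_inc hv fun ⟨y, hy⟩ =>
      h ⟨y, hy.mono hle⟩, neg_zero]

theorem source_cur {v : DartSpace α β} (hv : v ∈ G.flowSpace) (x : α) :
    G.source (cur v) x = ∑ᶠ e, v (e, x) := by
  rw [source, finsum_mem_def]
  refine finsum_congr fun e => ?_
  by_cases h : G.Inc e x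
  · exact Set.indicator_of_mem (s := G.incidenceSet x) h _
  · rw [apply_eq_zero_of_not_inc hv h]
    exact Set.indicator_of_notMem (s := G.incidenceSet x) h _

/-! ### Stars and projections. -/

open Classical in
/-- The flow of the potential that is `1` at `x` and `0` elsewhere. -/
noncomputable def star (G : Graph α β) (x : α) : DartSpace α β :=
  ∑ᶠ e ∈ G.incidenceSet x, (lp.single 2 (e, x) (1 : ℝ) - lp.single 2 (G.rev (e, x)) (1 : ℝ))

/-- Each edge at `x` contributes through both of its darts, whence the `2`. Orthogonality to a star
thus means having no source at its centre. -/
theorem inner_star (hfin : G.IsLocallyFinite) {v : DartSpace α β} (hv : v ∈ G.flowSpace) (x : α) :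
    inner ℝ (G.star x) v = 2 * G.source (cur v) x := by
  classical
  rw [star, source, finsum_mem_eq_finite_toFinset_sum _ (hfin.finite_incidenceSet x),
    finsum_mem_eq_finite_toFinset_sum _ (hfin.finite_incidenceSet x), sum_inner, Finset.mul_sum]
  refine Finset.sum_congr rfl fun e _ => ?_
  rw [inner_sub_left, lp.inner_single_left, lp.inner_single_left, hv]
  simp [cur]
  ring

theorem star_mem (G : Graph α β) (x : α) : G.star x ∈ G.flowSpace := by
  classical
  refine finsum_mem_induction (· ∈ G.flowSpace) (zero_mem _) (fun _ _ => add_mem)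
    fun e _ d => ?_
  simp only [lp.coeFn_sub, Pi.sub_apply, lp.single_apply, Pi.single_apply,
    (rev_involutive G).injective.eq_iff]
  have : (G.rev d = (e, x)) ↔ d = G.rev (e, x) := (rev_involutive G).eq_iff
  simp only [this, neg_sub]

open Classical in
theorem star_apply (hfin : G.IsLocallyFinite) {e : β} {x y z : α} (h : G.IsLink e y z) :
    G.star x (e, y) = (if y = x then 1 else 0) - (if z = x then 1 else 0) := by
  rw [star, finsum_mem_eq_finite_toFinset_sum _ (hfin.finite_incidenceSet x), lp.coeFn_sum,
    Finset.sum_apply]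
  have h1 : ∀ e', (e, y) = G.rev (e', x) ↔ (e, z) = (e', x) := fun e' => by
    rw [← rev_of_isLink h, (rev_involutive G).injective.eq_iff.symm, rev_involutive]
  simp only [lp.coeFn_sub, Pi.sub_apply, lp.single_apply, Pi.single_apply, h1,
    Finset.sum_sub_distrib, Prod.mk.injEq]
  have h2 : ∀ t, G.Inc e t → ∑ e' ∈ (hfin.finite_incidenceSet x).toFinset,
      (if e = e' ∧ t = x then (1 : ℝ) else 0) = if t = x then 1 else 0 := by
    intro t ht
    by_cases htx : t = x
    · subst htx
      simp [ht]
    · simp [htx]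
  rw [h2 y h.inc_left, h2 z h.inc_right]

open Classical in
theorem cur_star (hfin : G.IsLocallyFinite) (x : α) :
    cur (G.star x) = G.flowOf (Pi.single x 1) := by
  ext e y
  by_cases h : G.Inc e y
  · obtain ⟨z, h⟩ := h
    rw [flowOf_of_isLink _ h, cur, star_apply hfin h]
    simp [Pi.single_apply]
  · rw [flowOf_of_not_inc _ h]
    exact apply_eq_zero_of_not_inc (star_mem G x) h

theorem star_of_notMem {x : α} (hx : x ∉ V(G)) : G.star x = 0 :=
  finsum_mem_eq_zero_of_forall_eq_zero fun _ he => absurd he.vertex_mem hx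

/-- The flows of the potentials supported in `S`. -/
noncomputable def starSpan (G : Graph α β) (S : Set α) : Submodule ℝ (DartSpace α β) :=
  Submodule.span ℝ (G.star '' S)

theorem starSpan_mono {S S' : Set α} (h : S ⊆ S') : G.starSpan S ≤ G.starSpan S' :=
  Submodule.span_mono (Set.image_mono h)

theorem starSpan_le_flowSpace (S : Set α) : G.starSpan S ≤ G.flowSpace := by
  rw [starSpan, Submodule.span_le]
  rintro _ ⟨x, -, rfl⟩
  exact star_mem G x

theorem finiteDimensional_starSpan {S : Set α} (hS : S.Finite) :
    FiniteDimensional ℝ (G.starSpan S) :=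
  FiniteDimensional.span_of_finite ℝ (hS.image _)

theorem exists_mem_starSpan (hfin : G.IsLocallyFinite) {S : Set α} (hS : S.Finite) {u : α → ℝ}
    (hu : ∀ x ∉ S, u x = 0) : ∃ v ∈ G.starSpan S, cur v = G.flowOf u := by
  classical
  refine ⟨∑ x ∈ hS.toFinset, u x • G.star x, sum_mem fun x hx => Submodule.smul_mem _ _
    (Submodule.subset_span ⟨x, by simpa using hx, rfl⟩), ?_⟩
  ext e y
  rw [cur, lp.coeFn_sum, Finset.sum_apply]
  by_cases h : G.Inc e y
  · obtain ⟨z, h⟩ := h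
    have key : ∀ t, ∑ x ∈ hS.toFinset, u x * (if t = x then 1 else 0) = u t := by
      intro t
      by_cases ht : t ∈ S
      · simp [ht]
      · simp [ht, hu t ht]
    simp only [lp.coeFn_smul, Pi.smul_apply, star_apply hfin h, smul_eq_mul, mul_sub,
      Finset.sum_sub_distrib, key]
    rw [flowOf_of_isLink u h]
  · rw [flowOf_of_not_inc u h]
    refine Finset.sum_eq_zero fun x _ => ?_
    rw [lp.coeFn_smul, Pi.smul_apply, apply_eq_zero_of_not_inc (star_mem G x) h, smul_zero]

theorem exists_potential_of_mem_starSpan (hfin : G.IsLocallyFinite) {S : Set α}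
    {v : DartSpace α β} (hv : v ∈ G.starSpan S) :
    ∃ u : α → ℝ, (∀ x ∉ S, u x = 0) ∧ cur v = G.flowOf u := by
  classical
  induction hv using Submodule.span_induction with
  | mem v hv =>
    obtain ⟨x, hx, rfl⟩ := hv
    refine ⟨Pi.single x 1, fun y hy => ?_, cur_star hfin x⟩
    rw [Pi.single_apply, if_neg]
    rintro rfl
    exact hy hx
  | zero =>
    refine ⟨0, fun _ _ => rfl, ?_⟩
    rw [← zero_smul ℝ (0 : α → ℝ), flowOf_smul, zero_smul]
    rfl
  | add v w _ _ hv hw =>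
    obtain ⟨u, hu, hv⟩ := hv
    obtain ⟨u', hu', hw⟩ := hw
    refine ⟨u + u', fun x hx => by simp [hu x hx, hu' x hx], ?_⟩
    rw [flowOf_add, ← hv, ← hw]
    rfl
  | smul c v _ hv =>
    obtain ⟨u, hu, hv⟩ := hv
    refine ⟨c • u, fun x hx => by simp [hu x hx], ?_⟩
    rw [flowOf_smul, ← hv]
    rfl

theorem mem_starSpan_orthogonal {S : Set α} {v : DartSpace α β}
    (h : ∀ x ∈ S, inner ℝ (G.star x) v = 0) : v ∈ (G.starSpan S)ᗮ := by
  rw [Submodule.mem_orthogonal]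
  intro w hw
  induction hw using Submodule.span_induction with
  | mem w hw =>
    obtain ⟨x, hx, rfl⟩ := hw
    exact h x hx
  | zero => exact inner_zero_left _
  | add w w' _ _ hw hw' => rw [inner_add_left, hw, hw', add_zero]
  | smul c w _ hw => rw [inner_smul_left, hw, mul_zero]

/-- The projection to the flows of potentials supported in a finite set `S` is characterized by its
sources in `S`. -/
theorem starProjection_starSpan_eq_iff (hfin : G.IsLocallyFinite) {S : Set α}
    [(G.starSpan S).HasOrthogonalProjection] {v θ : DartSpace α β} (hθ : θ ∈ G.flowSpace) :
    (G.starSpan S).starProjection θ = v ↔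
      v ∈ G.starSpan S ∧ ∀ x ∈ S, G.source (cur v) x = G.source (cur θ) x := by
  constructor
  · rintro rfl
    have hm := Submodule.starProjection_apply_mem (G.starSpan S) θ
    refine ⟨hm, fun x hx => ?_⟩
    have h := (Submodule.mem_orthogonal _ _).1
      (Submodule.sub_starProjection_mem_orthogonal (K := G.starSpan S) θ) (G.star x)
      (Submodule.subset_span ⟨x, hx, rfl⟩)
    rw [inner_sub_right, inner_star hfin hθ, inner_star hfin (starSpan_le_flowSpace S hm)] at h
    linarith
  · rintro ⟨hv, h⟩
    refine Submodule.eq_starProjection_of_mem_orthogonal hv (mem_starSpan_orthogonal fun x hx => ?_)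
    rw [inner_sub_right, inner_star hfin hθ, inner_star hfin (starSpan_le_flowSpace S hv), h x hx,
      sub_self]

open Classical in
/-- A connected graph has a flow of strength `1` from `p` to `q` that lives on finitely many
vertices. -/
theorem exists_unitFlow (hconn : G.toSimpleGraph.Connected)
    (hfin : G.IsLocallyFinite) {p : α} (hp : p ∈ V(G)) :
    ∀ q ∈ V(G), ∃ θ : DartSpace α β, (∀ᶠ T in atTop, θ ∈ (G.cutNetwork T).flowSpace) ∧
      θ ∈ G.flowSpace ∧
      ∀ x, G.source (cur θ) x = (if x = p then 1 else 0) - (if x = q then 1 else 0) := by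
  refine induction_of_connected hconn hp ⟨0, by simp, zero_mem _, fun x => ?_⟩ ?_
  · rw [source_cur (zero_mem _)]
    simp
  rintro e y z h ⟨θ, h1, h2, h3⟩
  -- To move the sink from `y` to `z`, add a unit current through `e`. It lives in any subgraph
  -- containing `e`, in particular in the cut networks of large `T`.
  have key : ∀ H : Graph α β, H.IsLink e y z →
      (lp.single 2 (e, y) (1 : ℝ) - lp.single 2 (e, z) (1 : ℝ) : DartSpace α β) ∈ H.flowSpace := by
    intro H hl d
    simp only [lp.coeFn_sub, Pi.sub_apply, lp.single_apply, Pi.single_apply]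
    have hy : H.rev d = (e, y) ↔ d = (e, z) := by
      rw [← rev_of_isLink hl, (rev_involutive H).eq_iff]
    have hz : H.rev d = (e, z) ↔ d = (e, y) := by
      rw [← rev_of_isLink hl.symm, (rev_involutive H).eq_iff]
    simp only [hy, hz, neg_sub]
  have hmem := add_mem h2 (key G h)
  refine ⟨_, ?_, hmem, fun x => ?_⟩
  · filter_upwards [h1, eventually_ge_atTop {⟨y, h.left_mem⟩, ⟨z, h.right_mem⟩}] with T hT hT'
    refine add_mem hT (key _ ⟨h, ?_, ?_⟩)
    · exact mem_verts (x := ⟨y, h.left_mem⟩) |>.2 (hT' (by simp))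
    · exact mem_verts (x := ⟨z, h.right_mem⟩) |>.2 (hT' (by simp))
  · have h4 := inner_star hfin hmem x
    rw [inner_add_right, inner_star hfin h2, h3, inner_sub_right,
      real_inner_comm (lp.single 2 (e, y) 1), real_inner_comm (lp.single 2 (e, z) 1),
      lp.inner_single_left, lp.inner_single_left, star_apply hfin h, star_apply hfin h.symm] at h4
    simp only [eq_comm (b := x), RCLike.inner_apply, conj_trivial] at h4 ⊢
    linarith

/-! ### Cut networks and the even flow. -/

theorem cutNetwork_le (T : Finset V(G)) : G.cutNetwork T ≤ G := induce_le (verts_subset T)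

theorem cutNetwork_mono {S T : Finset V(G)} (h : S ⊆ T) : G.cutNetwork S ≤ G.cutNetwork T :=
  ⟨verts_mono h, fun _ _ _ hl => ⟨hl.1, verts_mono h hl.2.1, verts_mono h hl.2.2⟩⟩

theorem IsLocallyFinite.mono (hfin : G.IsLocallyFinite) {H : Graph α β} (hle : H ≤ G) :
    H.IsLocallyFinite := fun x _ =>
  (hfin.finite_incidenceSet x).subset fun _ ⟨y, hy⟩ => ⟨y, hy.mono hle⟩

theorem eventually_mem_verts {x : α} (hx : x ∈ V(G)) :
    ∀ᶠ T : Finset V(G) in atTop, x ∈ G.verts T := by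
  filter_upwards [eventually_ge_atTop {⟨x, hx⟩}] with T hT
  exact mem_verts (x := ⟨x, hx⟩) |>.2 (hT (by simp))

theorem source_cur_of_le {H : Graph α β} (hle : H ≤ G) {v : DartSpace α β} (hv : v ∈ H.flowSpace)
    (x : α) : H.source (cur v) x = G.source (cur v) x := by
  rw [source_cur hv, source_cur (flowSpace_mono hle hv)]

/-- The sourceless flows that live in the cut network of `T`. -/
noncomputable def cycleSpace (G : Graph α β) (T : Finset V(G)) : Submodule ℝ (DartSpace α β) :=
  (G.cutNetwork T).flowSpace ⊓ (G.starSpan Set.univ)ᗮ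

theorem cycleSpace_mono : Monotone G.cycleSpace := fun _ _ h =>
  inf_le_inf_right _ (flowSpace_mono (cutNetwork_mono h))

instance (T : Finset V(G)) : (G.cycleSpace T).HasOrthogonalProjection := by
  have : CompleteSpace (G.cycleSpace T) :=
    ((isClosed_flowSpace _).inter (Submodule.isClosed_orthogonal _)).completeSpace_coe
  infer_instance

instance (T : Finset V(G)) : (G.starSpan (G.verts T)).HasOrthogonalProjection := by
  have := finiteDimensional_starSpan (G := G) (finite_verts T)
  infer_instance

instance (T : Finset V(G)) :
    ((G.cutNetwork T).starSpan (G.verts T)).HasOrthogonalProjection := by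
  have := finiteDimensional_starSpan (G := G.cutNetwork T) (finite_verts T)
  infer_instance

/-- In the cut network, flows split orthogonally into potential flows and cycles. Stars of `G` and
of the cut network have the same inner products with flows of the latter, since both measure the
source. -/
theorem starSpan_starProjection_eq_sub (hfin : G.IsLocallyFinite) {T : Finset V(G)}
    {θ : DartSpace α β} (hθ : θ ∈ (G.cutNetwork T).flowSpace) :
    ((G.cutNetwork T).starSpan (G.verts T)).starProjection θ =
      θ - (G.cycleSpace T).starProjection θ := by
  have hfin' := hfin.mono (cutNetwork_le T)
  set v := ((G.cutNetwork T).starSpan (G.verts T)).starProjection θ with hv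
  obtain ⟨hvm, hvs⟩ := (starProjection_starSpan_eq_iff hfin' hθ).1 hv.symm
  have hvf := starSpan_le_flowSpace _ hvm
  have hstar : ∀ w ∈ (G.cutNetwork T).flowSpace, ∀ x,
      inner ℝ (G.star x) w = inner ℝ ((G.cutNetwork T).star x) w := fun w hw x => by
    rw [inner_star hfin (flowSpace_mono (cutNetwork_le T) hw), inner_star hfin' hw,
      source_cur_of_le (cutNetwork_le T) hw]
  rw [eq_sub_iff_add_eq, add_comm, ← eq_sub_iff_add_eq]
  refine Submodule.eq_starProjection_of_mem_orthogonal
    ⟨sub_mem hθ hvf, mem_starSpan_orthogonal fun x _ => ?_⟩ ?_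
  · rw [hstar _ (sub_mem hθ hvf)]
    by_cases hx : x ∈ G.verts T
    · rw [inner_sub_right, inner_star hfin' hθ, inner_star hfin' hvf, hvs x hx, sub_self]
    · rw [star_of_notMem (G := G.cutNetwork T) hx, inner_zero_left]
  · rw [sub_sub_cancel, Submodule.mem_orthogonal]
    rintro w ⟨hw, hw'⟩
    have h : w ∈ ((G.cutNetwork T).starSpan (G.verts T))ᗮ := mem_starSpan_orthogonal fun x _ => by
      rw [← hstar w hw]
      exact (Submodule.mem_orthogonal _ _).1 hw' _ (Submodule.subset_span ⟨x, trivial, rfl⟩)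
    rw [real_inner_comm]
    exact (Submodule.mem_orthogonal _ _).1 h v hvm

open Classical in
/-- The flow of a potential on the cut network of `T` is a flow of a potential supported in `T`. -/
theorem exists_mem_starSpan_cutNetwork (hfin : G.IsLocallyFinite) (T : Finset V(G)) (u : α → ℝ) :
    ∃ v ∈ (G.cutNetwork T).starSpan (G.verts T), cur v = (G.cutNetwork T).flowOf u := by
  obtain ⟨v, hv, h⟩ := exists_mem_starSpan (hfin.mono (cutNetwork_le T)) (finite_verts T)
    (u := fun x => if x ∈ G.verts T then u x else 0) (fun x hx => if_neg hx)
  refine ⟨v, hv, h.trans ?_⟩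
  ext e x
  by_cases hi : (G.cutNetwork T).Inc e x
  · obtain ⟨y, hl⟩ := hi
    rw [flowOf_of_isLink _ hl, flowOf_of_isLink _ hl]
    rw [if_pos hl.2.1, if_pos hl.2.2]
  · rw [flowOf_of_not_inc _ hi, flowOf_of_not_inc _ hi]

open Classical in
/-- The unit current of the cut network of `T` is a projection of any unit flow. -/
theorem isUnitCurrent_cutNetwork_iff (hfin : G.IsLocallyFinite) {T : Finset V(G)} {p q : α}
    {θ : DartSpace α β} (hθ : θ ∈ (G.cutNetwork T).flowSpace)
    (hs : ∀ x, G.source (cur θ) x = (if x = p then 1 else 0) - (if x = q then 1 else 0))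
    (j : β → α → ℝ) :
    (G.cutNetwork T).IsUnitCurrent p q j ↔ j = cur (θ - (G.cycleSpace T).starProjection θ) := by
  have hfin' := hfin.mono (cutNetwork_le T)
  rw [← starSpan_starProjection_eq_sub hfin hθ]
  set H := G.cutNetwork T with hH
  have hs' : ∀ x, H.source (cur θ) x = (if x = p then 1 else 0) - (if x = q then 1 else 0) :=
    fun x => by rw [source_cur_of_le (cutNetwork_le T) hθ, hs]
  constructor
  · rintro ⟨⟨u, rfl⟩, hu⟩
    obtain ⟨v, hv, h⟩ := exists_mem_starSpan_cutNetwork hfin T u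
    rw [← h, (starProjection_starSpan_eq_iff hfin' hθ).2 ⟨hv, fun x hx => ?_⟩]
    rw [h, hs']
    exact hu x hx
  · rintro rfl
    obtain ⟨hm, h⟩ := (starProjection_starSpan_eq_iff (S := G.verts T) hfin' hθ).1 rfl
    obtain ⟨u, -, hu⟩ := exists_potential_of_mem_starSpan hfin' hm
    exact ⟨⟨u, hu⟩, fun x hx => (h x hx).trans (hs' x)⟩

/-- The even flow is a projection of any unit flow. -/
theorem isEvenFlow_iff {p q : α} {θ : DartSpace α β}
    {w : DartSpace α β}
    (hw : Tendsto (fun T => θ - (G.cycleSpace T).starProjection θ) atTop (𝓝 w))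
    (hj : ∀ᶠ T in atTop, ∀ j, (G.cutNetwork T).IsUnitCurrent p q j ↔
      j = cur (θ - (G.cycleSpace T).starProjection θ)) (i : β → α → ℝ) :
    G.IsEvenFlow p q i ↔ i = cur w := by
  constructor
  · rintro ⟨j, h1, h2⟩
    refine eq_cur_of_tendsto hw (h2.congr' ?_)
    filter_upwards [h1, hj] with T hT hT'
    rw [(hT' _).1 hT]
  · rintro rfl
    exact ⟨_, hj.mono fun T h => (h _).2 rfl, tendsto_energy_sub hw⟩

/-! ### Short networks and the odd flow. -/

theorem shortMap_of_mem {T : Finset V(G)} {x : α} (hx : x ∈ G.verts T) :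
    G.shortMap T x = some x := if_pos hx

theorem shortMap_of_notMem {T : Finset V(G)} {x : α} (hx : x ∉ G.verts T) :
    G.shortMap T x = none := if_neg hx

theorem unshort_flowOf (T : Finset V(G)) (u : Option α → ℝ) :
    G.unshort T ((G.shortNetwork T).flowOf u) = G.flowOf (u ∘ G.shortMap T) := by
  ext e x
  by_cases h : G.Inc e x
  · obtain ⟨y, h⟩ := h
    rw [flowOf_of_isLink _ h, unshort, if_pos h.inc_left,
      flowOf_of_isLink (G := G.shortNetwork T) _ (h.map (G.shortMap T))]
    rfl
  · rw [flowOf_of_not_inc _ h, unshort, if_neg h]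

theorem shortNetwork_inc_some {T : Finset V(G)} {x : α} {e : β} :
    (G.shortNetwork T).Inc e (some x) ↔ G.Inc e x ∧ x ∈ G.verts T := by
  rw [shortNetwork, map_inc]
  constructor
  · rintro ⟨y, hy, h⟩
    by_cases hyT : y ∈ G.verts T
    · rw [shortMap_of_mem hyT, Option.some_inj] at h
      exact h ▸ ⟨hy, hyT⟩
    · rw [shortMap_of_notMem hyT] at h
      cases h
  · rintro ⟨h, hx⟩
    exact ⟨x, h, (shortMap_of_mem hx).symm⟩

theorem source_shortNetwork_some {T : Finset V(G)} {x : α} (hx : x ∈ G.verts T)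
    (j : β → Option α → ℝ) :
    (G.shortNetwork T).source j (some x) = G.source (G.unshort T j) x := by
  have : (G.shortNetwork T).incidenceSet (some x) = G.incidenceSet x := by
    ext e
    simp [shortNetwork_inc_some, hx]
  rw [source, source, this]
  refine finsum_mem_congr rfl fun e he => ?_
  rw [unshort, if_pos (show G.Inc e x from he), shortMap_of_mem hx]

/-- The currents leaving the two ends of an edge cancel, so the end at infinity balances those in
`T`. Looplessness keeps the two ends distinct in the sum. -/
theorem flowOf_shortNetwork_none [G.Loopless] (T : Finset V(G)) (u : Option α → ℝ) (e : β) :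
    (G.shortNetwork T).flowOf u e none =
      - ∑ x ∈ (finite_verts T).toFinset, G.unshort T ((G.shortNetwork T).flowOf u) e x := by
  classical
  rw [unshort_flowOf]
  by_cases he : e ∈ E(G)
  · obtain ⟨x, y, h⟩ := exists_isLink_of_mem_edgeSet he
    have hsum : ∑ z ∈ (finite_verts T).toFinset, G.flowOf (u ∘ G.shortMap T) e z =
        (if x ∈ G.verts T then G.flowOf (u ∘ G.shortMap T) e x else 0) +
        (if y ∈ G.verts T then G.flowOf (u ∘ G.shortMap T) e y else 0) := by
      simp only [← Set.Finite.mem_toFinset (finite_verts T)]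
      rw [← Finset.sum_ite_eq' _ x, ← Finset.sum_ite_eq' _ y, ← Finset.sum_add_distrib]
      refine Finset.sum_congr rfl fun z _ => ?_
      by_cases hzx : z = x
      · subst hzx
        simp [h.ne]
      by_cases hzy : z = y
      · subst hzy
        simp [hzx]
      rw [if_neg hzx, if_neg hzy, add_zero, flowOf_of_not_inc]
      intro hi
      rcases hi.eq_or_eq_of_isLink h with h | h
      exacts [hzx h, hzy h]
    rw [hsum, flowOf_of_isLink _ h, flowOf_of_isLink _ h.symm]
    have hl := h.map (G.shortMap T)
    by_cases hx : x ∈ G.verts T <;> by_cases hy : y ∈ G.verts T <;>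
      simp only [hx, hy, if_true, if_false, Function.comp_apply, shortMap_of_mem,
        shortMap_of_notMem, not_false_eq_true] at hl ⊢
    · rw [flowOf_of_not_inc]
      · ring
      · intro hi
        rcases hi.eq_or_eq_of_isLink hl with h | h <;> cases h
    · rw [flowOf_of_isLink u (G := G.shortNetwork T) hl.symm]
      ring
    · rw [flowOf_of_isLink u (G := G.shortNetwork T) hl]
      ring
    · rw [flowOf_of_isLink u (G := G.shortNetwork T) hl]
      ring
  · rw [flowOf_of_not_inc, Finset.sum_eq_zero, neg_zero]
    · intro x _
      exact flowOf_of_not_inc _ (not_inc_of_notMem_edgeSet he)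
    · exact not_inc_of_notMem_edgeSet he

theorem source_shortNetwork_none [G.Loopless] (hfin : G.IsLocallyFinite) (T : Finset V(G))
    (u : Option α → ℝ) :
    (G.shortNetwork T).source ((G.shortNetwork T).flowOf u) none =
      - ∑ x ∈ (finite_verts T).toFinset,
        (G.shortNetwork T).source ((G.shortNetwork T).flowOf u) (some x) := by
  rw [source_flowOf]
  simp only [flowOf_shortNetwork_none]
  rw [finsum_neg_distrib, finsum_sum_comm]
  · congr 1
    refine Finset.sum_congr rfl fun x hx => ?_
    rw [source_shortNetwork_some (by simpa using hx), unshort_flowOf, source_flowOf]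
  · intro x hx
    refine (hfin.finite_incidenceSet x).subset fun e he => ?_
    by_contra hi
    refine he ?_
    simp only [unshort_flowOf]
    exact flowOf_of_not_inc _ hi

theorem vertexSet_shortNetwork_subset (T : Finset V(G)) {x : Option α}
    (hx : x ∈ V(G.shortNetwork T)) : x = none ∨ ∃ y ∈ G.verts T, x = some y := by
  obtain ⟨y, -, rfl⟩ := hx
  by_cases hy : y ∈ G.verts T
  · exact Or.inr ⟨y, hy, shortMap_of_mem hy⟩
  · exact Or.inl (shortMap_of_notMem hy)

open Classical in
/-- The unit current of the short network of `T` is a projection of any unit flow. -/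
theorem unshort_eq_of_isUnitCurrent (hfin : G.IsLocallyFinite) {T : Finset V(G)} {p q : α}
    {θ : DartSpace α β} (hθ : θ ∈ G.flowSpace)
    (hs : ∀ x, G.source (cur θ) x = (if x = p then 1 else 0) - (if x = q then 1 else 0))
    {j : β → Option α → ℝ} (hj : (G.shortNetwork T).IsUnitCurrent (some p) (some q) j) :
    G.unshort T j = cur ((G.starSpan (G.verts T)).starProjection θ) := by
  obtain ⟨⟨u, rfl⟩, hu⟩ := hj
  obtain ⟨v, hv, h⟩ := exists_mem_starSpan hfin (finite_verts T)
    -- Subtracting the value at infinity leaves the flow unchanged and makes the potential vanish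
    -- off `T`.
    (u := fun x => u (G.shortMap T x) - u none)
    (fun x hx => by rw [shortMap_of_notMem hx, sub_self])
  have h' : cur v = G.unshort T ((G.shortNetwork T).flowOf u) := by
    rw [h, unshort_flowOf]
    ext e x
    by_cases hi : G.Inc e x
    · obtain ⟨y, hl⟩ := hi
      rw [flowOf_of_isLink _ hl, flowOf_of_isLink _ hl]
      simp
    · rw [flowOf_of_not_inc _ hi, flowOf_of_not_inc _ hi]
  rw [← h', (starProjection_starSpan_eq_iff hfin hθ).2 ⟨hv, fun x hx => ?_⟩]
  rw [h', hs, ← source_shortNetwork_some hx, hu _ ⟨x, verts_subset T hx, shortMap_of_mem hx⟩]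
  simp only [Option.some_inj]

-- The projection of `θ` has a potential vanishing off `T`, extended by `0` at infinity. Kirchhoff's
-- law at infinity follows by conservation, since the sources at `p` and `q` cancel.
open Classical in
theorem exists_isUnitCurrent_shortNetwork [G.Loopless] (hfin : G.IsLocallyFinite)
    {T : Finset V(G)} {p q : α} (hp : p ∈ G.verts T) (hq : q ∈ G.verts T)
    {θ : DartSpace α β} (hθ : θ ∈ G.flowSpace)
    (hs : ∀ x, G.source (cur θ) x = (if x = p then 1 else 0) - (if x = q then 1 else 0)) :
    ∃ j, (G.shortNetwork T).IsUnitCurrent (some p) (some q) j := by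
  obtain ⟨hm, h⟩ := (starProjection_starSpan_eq_iff (S := G.verts T) hfin hθ).1 rfl
  obtain ⟨u, hu0, hu⟩ := exists_potential_of_mem_starSpan hfin hm
  let u' : Option α → ℝ := fun x => x.elim 0 u
  have hcomp : u' ∘ G.shortMap T = u := by
    ext x
    by_cases hx : x ∈ G.verts T
    · simp [u', shortMap_of_mem hx]
    · simp [u', shortMap_of_notMem hx, hu0 x hx]
  have hsome : ∀ x ∈ G.verts T, (G.shortNetwork T).source ((G.shortNetwork T).flowOf u') (some x) =
      (if x = p then 1 else 0) - (if x = q then 1 else 0) := by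
    intro x hx
    rw [source_shortNetwork_some hx, unshort_flowOf, hcomp, ← hu, h x hx, hs]
  refine ⟨_, ⟨u', rfl⟩, fun x hx => ?_⟩
  obtain rfl | ⟨y, hy, rfl⟩ := vertexSet_shortNetwork_subset T hx
  · rw [source_shortNetwork_none hfin,
      Finset.sum_congr rfl fun x hx => hsome x (by simpa using hx)]
    simp [Finset.sum_sub_distrib, hp, hq]
  · rw [hsome y hy]
    simp only [Option.some_inj]

open Classical in
/-- The odd flow is a projection of any unit flow. -/
theorem isOddFlow_iff [G.Loopless] (hfin : G.IsLocallyFinite) {p q : α}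
    (hp : p ∈ V(G)) (hq : q ∈ V(G)) {θ : DartSpace α β} (hθ : θ ∈ G.flowSpace)
    (hs : ∀ x, G.source (cur θ) x = (if x = p then 1 else 0) - (if x = q then 1 else 0))
    {w : DartSpace α β}
    (hw : Tendsto (fun T => (G.starSpan (G.verts T)).starProjection θ) atTop (𝓝 w))
    (i : β → α → ℝ) : G.IsOddFlow p q i ↔ i = cur w := by
  constructor
  · rintro ⟨j, h1, h2⟩
    refine eq_cur_of_tendsto hw (h2.congr' ?_)
    filter_upwards [h1] with T hT
    rw [unshort_eq_of_isUnitCurrent hfin hθ hs hT]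
  · rintro rfl
    have hex : ∀ᶠ T in atTop, ∃ j, (G.shortNetwork T).IsUnitCurrent (some p) (some q) j := by
      filter_upwards [eventually_mem_verts hp, eventually_mem_verts hq] with T hpT hqT
      exact exists_isUnitCurrent_shortNetwork hfin hpT hqT hθ hs
    obtain ⟨j, hj⟩ := hex.choice
    refine ⟨j, hj, (tendsto_energy_sub hw).congr' ?_⟩
    filter_upwards [hj] with T hT
    rw [unshort_eq_of_isUnitCurrent hfin hθ hs hT]

/-! ### Equality of the two limits. -/

/-- A flow without sources that is a limit of flows of potentials is the flow of a harmonic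
potential; so it vanishes in a graph of the class `O_HD`. -/
theorem eq_zero_of_tendsto_potential (hconn : G.toSimpleGraph.Connected) (hOHD : G.IsOHD)
    {w : DartSpace α β} (hw : w ∈ G.flowSpace) (hs : ∀ x ∈ V(G), G.source (cur w) x = 0)
    (a : Finset V(G) → α → ℝ)
    (ha : ∀ e x y, G.IsLink e x y → Tendsto (fun T => a T x - a T y) atTop (𝓝 (cur w e x))) :
    w = 0 := by
  obtain ⟨o⟩ := hconn.nonempty
  -- Only differences along edges are known to converge; normalizing at `o`, convergence spreads
  -- along paths.
  have hlim : ∀ x ∈ V(G), ∃ l, Tendsto (fun T => a T x - a T o) atTop (𝓝 l) := by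
    refine induction_of_connected hconn o.2 ⟨0, by simp⟩ ?_
    rintro e x y h ⟨l, hl⟩
    refine ⟨l - cur w e x, (hl.sub (ha e x y h)).congr fun T => by ring⟩
  choose! u hu using hlim
  have hflow : cur w = G.flowOf u := by
    ext e x
    by_cases h : G.Inc e x
    · obtain ⟨y, h⟩ := h
      rw [flowOf_of_isLink u h]
      refine tendsto_nhds_unique (ha e x y h) (((hu x h.left_mem).sub (hu y h.right_mem)).congr
        fun T => by ring)
    · rw [flowOf_of_not_inc u h]
      exact apply_eq_zero_of_not_inc hw h
  have hconst := hOHD u (fun x hx => by rw [← hflow]; exact hs x hx)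
    (by rw [← hflow]; exact (energy_cur_ne_top w).lt_top)
  refine cur_injective (hflow.trans ?_)
  ext e x
  by_cases h : G.Inc e x
  · obtain ⟨y, h⟩ := h
    rw [flowOf_of_isLink u h, hconst x h.left_mem y h.right_mem, sub_self]
    rfl
  · rw [flowOf_of_not_inc u h]
    rfl

/-- In a graph of the class `O_HD` the even and the odd resistance between two vertices are well
defined, finite and equal. -/
theorem IsOHD.exists_resistance [G.Loopless] (hOHD : G.IsOHD) (hconn : G.toSimpleGraph.Connected)
    (hfin : G.IsLocallyFinite) {p q : α} (hp : p ∈ V(G)) (hq : q ∈ V(G)) :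
    ∃ r : ℝ≥0, (∀ s : ℝ≥0∞, G.IsEvenResistance p q s ↔ s = r) ∧
      (∀ s : ℝ≥0∞, G.IsOddResistance p q s ↔ s = r) := by
  obtain ⟨θ, hθT, hθ, hs⟩ := exists_unitFlow hconn hfin hp q hq
  have hodd := Submodule.starProjection_tendsto_closure_iSup
    (fun T : Finset V(G) => G.starSpan (G.verts T)) (fun _ _ h => starSpan_mono (verts_mono h)) θ
  have heven := (Submodule.starProjection_tendsto_closure_iSup G.cycleSpace cycleSpace_mono
    θ).const_sub θ
  set v := (⨆ T : Finset V(G), G.starSpan (G.verts T)).topologicalClosure.starProjection θ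
  set w := θ - (⨆ T, G.cycleSpace T).topologicalClosure.starProjection θ
  have hfin' := fun T : Finset V(G) => hfin.mono (cutNetwork_le T)
  have hpot : ∀ T : Finset V(G), ∃ b : α → ℝ,
      cur ((G.starSpan (G.verts T)).starProjection θ) = G.flowOf b := fun T => by
    obtain ⟨b, -, hb⟩ := exists_potential_of_mem_starSpan hfin
      (Submodule.starProjection_apply_mem (G.starSpan (G.verts T)) θ)
    exact ⟨b, hb⟩
  have hpot' : ∀ T : Finset V(G), ∃ a : α → ℝ, cur (((G.cutNetwork T).starSpan
      (G.verts T)).starProjection θ) = (G.cutNetwork T).flowOf a := fun T => by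
    obtain ⟨a, -, ha⟩ := exists_potential_of_mem_starSpan (hfin' T)
      (Submodule.starProjection_apply_mem ((G.cutNetwork T).starSpan (G.verts T)) θ)
    exact ⟨a, ha⟩
  choose b hb using hpot
  choose a ha using hpot'
  have hmem : ∀ᶠ T in atTop, θ - (G.cycleSpace T).starProjection θ -
      (G.starSpan (G.verts T)).starProjection θ ∈ G.flowSpace := by
    filter_upwards [hθT] with T hT
    rw [← starSpan_starProjection_eq_sub hfin hT]
    exact sub_mem (flowSpace_mono (cutNetwork_le T) (mem_flowSpace_of_cur_eq (ha T)))
      (mem_flowSpace_of_cur_eq (hb T))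
  have hwv := heven.sub hodd
  have hf : w - v ∈ G.flowSpace := (isClosed_flowSpace G).mem_of_tendsto hwv hmem
  have hzero : w - v = 0 := by
    -- Once `x ∈ T`, both currents have the source of `θ` at `x`, so their difference has none; once
    -- both ends of an edge lie in `T`, `a T - b T` is a potential for that difference on it.
    refine eq_zero_of_tendsto_potential hconn hOHD hf (fun x hx => ?_) (fun T => a T - b T) ?_
    · have h1 : Tendsto (fun T => inner ℝ (G.star x) (θ - (G.cycleSpace T).starProjection θ -
          (G.starSpan (G.verts T)).starProjection θ)) atTop (𝓝 (inner ℝ (G.star x) (w - v))) :=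
        tendsto_const_nhds.inner hwv
      have h2 : inner ℝ (G.star x) (w - v) = 0 := by
        refine tendsto_nhds_unique h1 (tendsto_const_nhds.congr' ?_)
        filter_upwards [hθT, eventually_mem_verts hx] with T hT hxT
        rw [← starSpan_starProjection_eq_sub hfin hT]
        obtain ⟨hm, h⟩ := (starProjection_starSpan_eq_iff (S := G.verts T) hfin hθ).1 rfl
        obtain ⟨hm', h'⟩ := (starProjection_starSpan_eq_iff (S := G.verts T) (hfin' T) hT).1 rfl
        have hm'' := starSpan_le_flowSpace _ hm'
        rw [inner_sub_right, inner_star hfin (starSpan_le_flowSpace _ hm),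
          inner_star hfin (flowSpace_mono (cutNetwork_le T) hm''), h x hxT,
          ← source_cur_of_le (cutNetwork_le T) hm'', h' x hxT,
          source_cur_of_le (cutNetwork_le T) hT, sub_self]
      rw [inner_star hfin hf] at h2
      linarith
    · intro e x y h
      refine (tendsto_apply hwv e x).congr' ?_
      filter_upwards [hθT, eventually_mem_verts h.left_mem, eventually_mem_verts h.right_mem]
        with T hT hxT hyT
      have hl : (G.cutNetwork T).IsLink e x y := ⟨h, hxT, hyT⟩
      rw [← starSpan_starProjection_eq_sub hfin hT]
      have h1 := congrFun (congrFun (ha T) e) x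
      have h2 := congrFun (congrFun (hb T) e) x
      rw [flowOf_of_isLink _ hl] at h1
      rw [flowOf_of_isLink _ h] at h2
      refine (congrArg₂ (· - ·) h1 h2).trans ?_
      simp only [Pi.sub_apply]
      ring
  have hEven := isEvenFlow_iff (p := p) (q := q) heven
    (hθT.mono fun T hT => isUnitCurrent_cutNetwork_iff hfin hT hs)
  have hOdd := isOddFlow_iff hfin hp hq hθ hs hodd
  rw [sub_eq_zero.1 hzero] at hEven
  refine ⟨(energy (cur v)).toNNReal, fun s => ?_, fun s => ?_⟩ <;>
    rw [ENNReal.coe_toNNReal (energy_cur_ne_top v)]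
  · simp only [IsEvenResistance, hEven, exists_eq_left, eq_comm]
  · simp only [IsOddResistance, hOdd, exists_eq_left, eq_comm]

end Graph

theorem mainTheorem2 {α β : Type*} (G : Graph α β) [G.Loopless]
    (hconn : G.toSimpleGraph.Connected) (hfin : G.IsLocallyFinite)
    (hsmall : G.IsSmallish) (hsymm : G.IsSymmetrical) :
    (∀ p ∈ V(G), ∀ q ∈ V(G), p ≠ q →
      ∃ r : ℝ≥0, (∀ s : ℝ≥0∞, G.IsEvenResistance p q s ↔ s = r) ∧
        (∀ s : ℝ≥0∞, G.IsOddResistance p q s ↔ s = r)) ∧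
    G.IsOHD := by
  have hOHD := Graph.isOHD_of_isSmallish hconn hfin hsmall hsymm
  exact ⟨fun p hp q hq _ => hOHD.exists_resistance hconn hfin hp hq, hOHD⟩
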